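/- Let $R$ be an associative ring with unit, let $\mathrm{Mod}\text{-}R$ be the category of right $R$-modules and $\mathrm{mod}\text{-}R$ its subcategory of finitely presented modules. For a class $\mathcal{C}$ of right $R$-modules, $\operatorname{Add}(\mathcal{C})$ denotes the class of modules isomorphic to a direct summand of a direct sum of modules in $\mathcal{C}$, and $\operatorname{Add} T=\operatorname{Add}(\{T\})$; $\operatorname{Gen} T$ is the class of epimorphic images of direct sums of copies of $T$; $T^{\perp}=\{M : \operatorname{Ext}^1_R(T,M)=0\}$; and ${}^{\perp}\mathcal{C}=\{M : \operatorname{Ext}^1_R(M,C)=0 \text{ for all } C\in\mathcal{C}\}$. A right $R$-module $T$ is *$1$-tilting* if it has projective dimension at most $1$, $\operatorname{Ext}^i_R(T,T^{(\lambda)})=0$ for all $i>0$ and every cardinal $\lambda$, and there is an exact sequence $0\to R\to T_0\to T_1\to 0$ with $T_0,T_1\in\operatorname{Add} T$. Its tilting class is $\operatorname{Gen} T$. Two $1$-tilting modules $T,U$ are *tilting equivalent* if $T^\perp=U^\perp$. A $1$-tilting module is *classical* if it is tilting equivalent to a finitely presented $1$-tilting module. A *$\mathcal{C}$-preenvelope*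 of a module $M$ is a homomorphism $\varphi:M\to C_M$ with $C_M\in\mathcal{C}$ through which every homomorphism from $M$ to a module in $\mathcal{C}$ factors; it is *special* if it is a monomorphism with $\operatorname{Coker}\varphi\in{}^{\perp}\mathcal{C}$; it is *finitely presented*, or *in* a class, if $C_M$ is. A class $\mathcal{X}\subseteq\mathrm{mod}\text{-}R$ is *covariantly finite* in $\mathrm{mod}\text{-}R$ if every module in $\mathrm{mod}\text{-}R$ has an $\mathcal{X}$-preenvelope, and $\varinjlim(\mathcal{X})$ is the class of direct limits of directed systems of modules in $\mathcal{X}$. **Theorem 2.6.** Let $T$ be a $1$-tilting right $R$-module with tilting class $\mathcal{T}=\operatorname{Gen} T$. The following are equivalent: 1. $T$ is classical; 2. $\mathcal{T}\cap{}^{\perp}\mathcal{T}\subseteq\operatorname{Add}(\mathcal{T}\cap{}^{\perp}\mathcal{T}\cap\mathrm{mod}\text{-}R)$; 3. the module $R_R$ admits a finitely presented special $\mathcal{T}$-preenvelope; 4. every finitely presented module admits a finitely presented special $\mathcal{T}$-preenvelope; 5. every finitely presented module in ${}^{\perp}\mathcal{T}$ admits a finitely presented special $\mathcal{T}$-preenvelope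 in $\operatorname{Add} T$. If these conditions hold, then $\mathcal{X}=\mathcal{T}\cap\mathrm{mod}\text{-}R$ is covariantly finite in $\mathrm{mod}\text{-}R$ and $\mathcal{T}=\varinjlim(\mathcal{X})$. -/

import Mathlib

universe u

namespace Tilting

open CategoryTheory

/-- The category of right `R`-modules: a right `R`-module is a left module over the opposite
ring. -/
abbrev ModR (R : Type u) [Ring R] : Type (u + 1) := ModuleCat.{u} Rᵐᵒᵖ

section

variable {R : Type u} [Ring R]

variable (R) in
/-- The ring `R` as a right module over itself. -/
abbrev regular : ModR R := ModuleCat.of Rᵐᵒᵖ R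

variable (R) in
/-- The class of finitely presented right `R`-modules. -/
def finPres : ObjectProperty (ModR R) :=
  fun M => Module.FinitePresentation Rᵐᵒᵖ M

/-- `Add 𝒞`: the modules isomorphic to a direct summand of a direct sum of modules in `𝒞`. -/
def Add (𝒞 : ObjectProperty (ModR R)) : ObjectProperty (ModR R) :=
  fun M => ∃ (I : Type u) (E : I → ModR R) (N : ModR R),
    (∀ i, 𝒞 (E i)) ∧ Nonempty ((M × N) ≃ₗ[Rᵐᵒᵖ] DirectSum I (fun i => E i))

/-- `Add T`: the modules isomorphic to a direct summand of a direct sum of copies of `T`. -/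
def AddOne (T : ModR R) : ObjectProperty (ModR R) := Add (fun E => E = T)

/-- `Gen T`: the epimorphic images of direct sums of copies of `T`. -/
def Gen (T : ModR R) : ObjectProperty (ModR R) :=
  fun M => ∃ (I : Type u) (p : (I →₀ T) →ₗ[Rᵐᵒᵖ] M), Function.Surjective p

/-- `T^⊥`: the modules `M` with `Ext¹(T, M) = 0`. -/
def rightPerp (T : ModR R) : ObjectProperty (ModR R) :=
  fun M => Subsingleton (Abelian.Ext T M 1)

/-- `^⊥𝒞`: the modules `M` with `Ext¹(M, C) = 0` for all `C` in `𝒞`. -/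
def leftPerp (𝒞 : ObjectProperty (ModR R)) : ObjectProperty (ModR R) :=
  fun M => ∀ C : ModR R, 𝒞 C → Subsingleton (Abelian.Ext M C 1)

/-- (Large) `1`-tilting right modules. -/
structure IsOneTilting (T : ModR R) : Prop where
  /-- The projective dimension of `T` is at most `1`. -/
  projDim : HasProjectiveDimensionLE T 1
  /-- `Ext^i(T, T^{(I)}) = 0` for all `i > 0` and all sets `I`. -/
  ext_directSum : ∀ (I : Type u) (i : ℕ), 0 < i →
    Subsingleton (Abelian.Ext T (ModuleCat.of Rᵐᵒᵖ (I →₀ T)) i)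
  /-- There is an exact sequence `0 → R → T₀ → T₁ → 0` with `T₀`, `T₁` in `Add T`. -/
  coresolution : ∃ (T₀ T₁ : ModR R) (f : R →ₗ[Rᵐᵒᵖ] T₀) (g : T₀ →ₗ[Rᵐᵒᵖ] T₁),
    AddOne T T₀ ∧ AddOne T T₁ ∧
      Function.Injective f ∧ Function.Exact f g ∧ Function.Surjective g

/-- Tilting equivalence: `T^⊥ = U^⊥`. -/
def TiltingEquivalent (T U : ModR R) : Prop := rightPerp T = rightPerp U

/-- A `1`-tilting module is classical if it is tilting equivalent to a finitely presented
`1`-tilting module. -/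
def IsClassical (T : ModR R) : Prop :=
  IsOneTilting T ∧ ∃ U : ModR R, IsOneTilting U ∧ finPres R U ∧ TiltingEquivalent T U

/-- `φ : M ⟶ C` is a `𝒞`-preenvelope of `M`. -/
def IsPreenvelope (𝒞 : ObjectProperty (ModR R)) {M C : ModR R} (φ : M ⟶ C) : Prop :=
  𝒞 C ∧ ∀ (D : ModR R) (f : M ⟶ D), 𝒞 D → ∃ g : C ⟶ D, φ ≫ g = f

/-- A `𝒞`-preenvelope is special if it is a monomorphism with cokernel in `^⊥𝒞`. -/
def IsSpecialPreenvelope (𝒞 : ObjectProperty (ModR R)) {M C : ModR R} (φ : M ⟶ C) : Prop :=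
  IsPreenvelope 𝒞 φ ∧ Mono φ ∧ leftPerp 𝒞 (Limits.cokernel φ)

/-- The class `𝒳` is a covariantly finite subcategory of the category of finitely presented
modules: it consists of finitely presented modules, and every finitely presented module has an
`𝒳`-preenvelope. -/
def IsCovariantlyFinite (𝒳 : ObjectProperty (ModR R)) : Prop :=
  𝒳 ≤ finPres R ∧
    ∀ A : ModR R, finPres R A → ∃ (C : ModR R) (φ : A ⟶ C), IsPreenvelope 𝒳 φ

/-- `lim→ 𝒳`: the modules that are the direct limit (colimit over a nonempty directed partially
ordered set) of a directed system of modules in `𝒳`. -/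
def directLimits (𝒳 : ObjectProperty (ModR R)) : ObjectProperty (ModR R) :=
  fun M => ∃ (I : Type u) (_ : PartialOrder I) (_ : IsDirectedOrder I) (_ : Nonempty I),
    𝒳.colimitsOfShape I M

end

end Tilting

/-! Two identities carry the proof: `Gen T = T^⊥` (`gen_eq_rightPerp`) and `Gen T ∩ ^⊥(Gen T) = Add
T` (`gen_inf_leftPerp_eq`). They make condition 2 hold for classical `T`, since a finitely presented
`U` equivalent to `T` has `Add U = Add T`. Given condition 2, the middle term of `0 → R → T₀ → T₁ →
0` is a summand of a direct sum of finitely presented modules in `Add T`. As `R` is cyclic, it lands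
in a finite subsum, which yields the preenvelope of `R`. Finite powers and pushouts carry it over to
every finitely presented module. Conversely, a finitely presented special preenvelope `R → C` makes
`C ⊕ C/R` a finitely presented tilting module equivalent to `T`. For the last claim, maps from
finitely presented modules into `Gen T` factor through finitely presented preenvelopes, and this
factorization property characterizes direct limits of modules in `𝒳`. -/

namespace Tilting

open CategoryTheory Abelian

/-! ### Consequences of the long exact Ext sequences. -/

section Abelian

universe w v

variable {C : Type u} [Category.{v} C] [Abelian C] [HasExt.{w} C]
  {S : ShortComplex C} (hS : S.ShortExact)

include hS

lemma exists_lift_of_ext {X : C} (h : Subsingleton (Ext X S.X₁ 1)) (f : X ⟶ S.X₃) :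
    ∃ g : X ⟶ S.X₂, g ≫ S.g = f := by
  obtain ⟨φ, hφ⟩ := Ext.covariant_sequence_exact₃ X hS (Ext.mk₀ f) (zero_add 1)
    (Subsingleton.elim _ _)
  obtain ⟨g, rfl⟩ := Ext.homEquiv₀.symm.surjective φ
  refine ⟨g, Ext.homEquiv₀.symm.injective ?_⟩
  simpa using hφ

lemma exists_extension_of_ext {Y : C} (h : Subsingleton (Ext S.X₃ Y 1)) (f : S.X₁ ⟶ Y) :
    ∃ g : S.X₂ ⟶ Y, S.f ≫ g = f := by
  obtain ⟨φ, hφ⟩ := Ext.contravariant_sequence_exact₁ hS Y (Ext.mk₀ f) (add_zero 1)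
    (Subsingleton.elim _ _)
  obtain ⟨g, rfl⟩ := Ext.homEquiv₀.symm.surjective φ
  refine ⟨g, Ext.homEquiv₀.symm.injective ?_⟩
  simpa using hφ

/-- The connecting map from `Hom(X, S.X₃)` is onto because the next term vanishes, and it kills
every map that lifts. -/
lemma subsingleton_ext_of_lifts {X : C} (h : Subsingleton (Ext X S.X₂ 1))
    (hl : ∀ f : X ⟶ S.X₃, ∃ g : X ⟶ S.X₂, g ≫ S.g = f) : Subsingleton (Ext X S.X₁ 1) := by
  refine subsingleton_of_forall_eq 0 fun x => ?_
  obtain ⟨y, rfl⟩ := Ext.covariant_sequence_exact₁ X hS x (Subsingleton.elim _ _) (zero_add 1)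
  obtain ⟨f, rfl⟩ := Ext.homEquiv₀.symm.surjective y
  obtain ⟨g, rfl⟩ := hl f
  simp only [Ext.homEquiv₀_symm_apply]
  rw [← Ext.mk₀_comp_mk₀, Ext.comp_assoc_of_second_deg_zero]
  simp

lemma subsingleton_ext_extension_source {Y : C} {n : ℕ} (h₁ : Subsingleton (Ext S.X₁ Y n))
    (h₃ : Subsingleton (Ext S.X₃ Y n)) : Subsingleton (Ext S.X₂ Y n) := by
  refine subsingleton_of_forall_eq 0 fun x => ?_
  obtain ⟨y, rfl⟩ := Ext.contravariant_sequence_exact₂ hS Y x (Subsingleton.elim _ _)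
  rw [Subsingleton.elim y 0, Ext.comp_zero]

lemma subsingleton_ext_quotient_target {X : C} {n : ℕ} (h₂ : Subsingleton (Ext X S.X₂ n))
    (h₁ : Subsingleton (Ext X S.X₁ (n + 1))) : Subsingleton (Ext X S.X₃ n) := by
  refine subsingleton_of_forall_eq 0 fun x => ?_
  obtain ⟨y, rfl⟩ := Ext.covariant_sequence_exact₃ X hS x rfl (Subsingleton.elim _ _)
  rw [Subsingleton.elim y 0, Ext.zero_comp]

lemma subsingleton_ext_succ_kernel_target {X : C} {n : ℕ}
    (h₃ : Subsingleton (Ext X S.X₃ n)) (h₂ : Subsingleton (Ext X S.X₂ (n + 1))) :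
    Subsingleton (Ext X S.X₁ (n + 1)) := by
  refine subsingleton_of_forall_eq 0 fun x => ?_
  obtain ⟨y, rfl⟩ := Ext.covariant_sequence_exact₁ X hS x (Subsingleton.elim _ _) rfl
  rw [Subsingleton.elim y 0, Ext.zero_comp]

omit hS in
lemma subsingleton_ext_of_retract {X X' Y : C} {n : ℕ} (i : X ⟶ X') (p : X' ⟶ X)
    (hip : i ≫ p = 𝟙 X) (h : Subsingleton (Ext X' Y n)) : Subsingleton (Ext X Y n) := by
  refine subsingleton_of_forall_eq 0 fun x => ?_
  rw [← x.mk₀_id_comp, ← hip, ← Ext.mk₀_comp_mk₀, Ext.comp_assoc_of_second_deg_zero,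
    Subsingleton.elim ((Ext.mk₀ p).comp x _) 0, Ext.comp_zero]

end Abelian

/-! ### Ext of modules and direct sums. -/

section Modules

variable {A : Type u} [Ring A]

lemma shortExact_of_linearMap {L M N : ModuleCat.{u} A} (f : L ⟶ M) (g : M ⟶ N)
    (hf : Function.Injective f) (hfg : Function.Exact f g) (hg : Function.Surjective g) :
    (ShortComplex.mk f g (by ext x; exact hfg.apply_apply_eq_zero x)).ShortExact where
  exact := (ShortComplex.ShortExact.moduleCat_exact_iff_function_exact _).2 hfg
  mono_f := (ModuleCat.mono_iff_injective _).2 hf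
  epi_g := (ModuleCat.epi_iff_surjective _).2 hg

lemma exists_injective_presentation (C : ModuleCat.{u} A) :
    ∃ (I Q : ModuleCat.{u} A) (f : C ⟶ I) (g : I ⟶ Q), Injective I ∧
      Function.Injective f ∧ Function.Exact f g ∧ Function.Surjective g := by
  obtain ⟨p⟩ := EnoughInjectives.presentation C
  refine ⟨p.J, ModuleCat.of A (p.J ⧸ LinearMap.range p.f.hom), p.f,
    ModuleCat.ofHom (Submodule.mkQ _), p.injective, (ModuleCat.mono_iff_injective _).1 p.mono,
    ?_, Submodule.mkQ_surjective _⟩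
  exact LinearMap.exact_map_mkQ_range p.f.hom

/-- With `C` embedded in an injective `J`, vanishing of `Ext¹(-, C)` means lifting maps along `J →
J/C`, and lifts out of a direct sum are built summand by summand. -/
lemma subsingleton_ext_directSum {I : Type u} (E : I → ModuleCat.{u} A) (C : ModuleCat.{u} A)
    (h : ∀ i, Subsingleton (Ext (E i) C 1)) :
    Subsingleton (Ext (ModuleCat.of A (DirectSum I fun i => E i)) C 1) := by
  classical
  obtain ⟨J, Q, f, g, hJ, hf, hfg, hg⟩ := exists_injective_presentation C
  refine subsingleton_ext_of_lifts (shortExact_of_linearMap f g hf hfg hg)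
    (Ext.subsingleton_of_injective _ _ 0) fun a => ?_
  choose b hb using fun i => exists_lift_of_ext (shortExact_of_linearMap f g hf hfg hg) (h i)
    (ModuleCat.ofHom (a.hom ∘ₗ DirectSum.lof A I (fun i => E i) i))
  refine ⟨ModuleCat.ofHom (DirectSum.toModule A I _ fun i => (b i).hom), ?_⟩
  ext : 1
  refine DirectSum.linearMap_ext _ fun i => ?_
  ext x
  have := congr($(hb i) x)
  simpa using this

end Modules

/-! ### Closure properties of `^⊥𝒞` and special preenvelopes. -/

section LeftPerp

variable {R : Type u} [Ring R]

lemma leftPerp_of_retract {𝒞 : ObjectProperty (ModR R)} {M N : ModR R} (i : M →ₗ[Rᵐᵒᵖ] N)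
    (p : N →ₗ[Rᵐᵒᵖ] M) (hip : p ∘ₗ i = LinearMap.id) (h : leftPerp 𝒞 N) : leftPerp 𝒞 M :=
  fun C hC => subsingleton_ext_of_retract (ModuleCat.ofHom i) (ModuleCat.ofHom p)
    (by rw [← ModuleCat.ofHom_comp, hip]; rfl) (h C hC)

lemma leftPerp_of_linearEquiv {𝒞 : ObjectProperty (ModR R)} {M N : ModR R} (e : M ≃ₗ[Rᵐᵒᵖ] N)
    (h : leftPerp 𝒞 N) : leftPerp 𝒞 M :=
  leftPerp_of_retract e.toLinearMap e.symm.toLinearMap (by ext; simp) h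

lemma leftPerp_directSum {𝒞 : ObjectProperty (ModR R)} {I : Type u} (E : I → ModR R)
    (h : ∀ i, leftPerp 𝒞 (E i)) :
    leftPerp 𝒞 (ModuleCat.of Rᵐᵒᵖ (DirectSum I fun i => E i)) :=
  fun C hC => subsingleton_ext_directSum E C fun i => h i C hC

lemma Add_leftPerp_le (𝒞 : ObjectProperty (ModR R)) : Add (leftPerp 𝒞) ≤ leftPerp 𝒞 := by
  rintro M ⟨I, E, N, hE, ⟨e⟩⟩
  refine leftPerp_of_retract (N := ModuleCat.of Rᵐᵒᵖ (DirectSum I fun i => E i))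
    (e.toLinearMap ∘ₗ LinearMap.inl _ _ _) (LinearMap.fst _ _ _ ∘ₗ e.symm.toLinearMap) ?_
    (leftPerp_directSum E hE)
  ext; simp

lemma Add_mono {𝒞 𝒟 : ObjectProperty (ModR R)} (h : 𝒞 ≤ 𝒟) : Add 𝒞 ≤ Add 𝒟 :=
  fun _ ⟨I, E, N, hE, e⟩ => ⟨I, E, N, fun i => h _ (hE i), e⟩

lemma leftPerp_of_exact {𝒞 : ObjectProperty (ModR R)} {L M N : ModR R} (f : L ⟶ M) (g : M ⟶ N)
    (hf : Function.Injective f) (hfg : Function.Exact f g) (hg : Function.Surjective g)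
    (hL : leftPerp 𝒞 L) (hN : leftPerp 𝒞 N) : leftPerp 𝒞 M :=
  fun C hC => subsingleton_ext_extension_source (shortExact_of_linearMap f g hf hfg hg)
    (hL C hC) (hN C hC)

lemma leftPerp_of_projective (𝒞 : ObjectProperty (ModR R)) (P : ModR R)
    [Module.Projective Rᵐᵒᵖ P] : leftPerp 𝒞 P := by
  have : Projective P := (IsProjective.iff_projective P).1 inferInstance
  exact fun C _ => HasProjectiveDimensionLT.subsingleton P 1 1 le_rfl C

lemma isSpecialPreenvelope_of_exact {𝒞 : ObjectProperty (ModR R)} {L M N : ModR R}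
    (f : L ⟶ M) (g : M ⟶ N)
    (hf : Function.Injective f) (hfg : Function.Exact f g) (hg : Function.Surjective g)
    (hM : 𝒞 M) (hN : leftPerp 𝒞 N) : IsSpecialPreenvelope 𝒞 f := by
  have hS := shortExact_of_linearMap f g hf hfg hg
  refine ⟨⟨hM, fun D a hD => exists_extension_of_ext hS (hN D hD) a⟩, hS.mono_f, ?_⟩
  have := hS.epi_g
  let e : Limits.cokernel f ≅ N :=
    (Limits.cokernelIsCokernel f).coconePointUniqueUpToIso hS.exact.gIsCokernel
  exact leftPerp_of_linearEquiv e.toLinearEquiv hN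

lemma IsSpecialPreenvelope.exists_exact {𝒞 : ObjectProperty (ModR R)} {M C : ModR R}
    {φ : M ⟶ C} (h : IsSpecialPreenvelope 𝒞 φ) :
    Function.Injective φ ∧
      leftPerp 𝒞 (ModuleCat.of Rᵐᵒᵖ (C ⧸ LinearMap.range φ.hom)) := by
  refine ⟨(ModuleCat.mono_iff_injective _).1 h.2.1, ?_⟩
  exact leftPerp_of_linearEquiv (ModuleCat.cokernelIsoRangeQuotient φ).symm.toLinearEquiv h.2.2

end LeftPerp

end Tilting

namespace Tilting

open CategoryTheory Abelian

/-! ### The class `Gen T` and its closure properties. -/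

section Gen

variable {R : Type u} [Ring R]

/-- The trace of `T` in `M` replaces the choice of an index set, so closure properties become
computations with suprema of ranges. -/
lemma gen_iff (T M : ModR R) :
    Gen T M ↔ ⨆ f : T →ₗ[Rᵐᵒᵖ] M, LinearMap.range f = ⊤ := by
  constructor
  · rintro ⟨I, p, hp⟩
    refine eq_top_iff.2 fun m _ => ?_
    obtain ⟨x, rfl⟩ := hp m
    induction x using Finsupp.induction_linear with
    | zero => simp
    | add x y hx hy => rw [map_add]; exact add_mem (hx trivial) (hy trivial)
    | single i t =>
      exact Submodule.mem_iSup_of_mem (p ∘ₗ Finsupp.lsingle i) ⟨t, rfl⟩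
  · intro h
    -- One copy of `T` for every map `T → M`. The scalars `ℕ` serve because the ring need not be
    -- commutative.
    refine ⟨T →ₗ[Rᵐᵒᵖ] M, Finsupp.lsum ℕ fun f => f, LinearMap.range_eq_top.1 ?_⟩
    refine eq_top_iff.2 (h ▸ iSup_le fun f => ?_)
    rintro _ ⟨t, rfl⟩
    exact ⟨Finsupp.single f t, by simp⟩

lemma gen_of_iSup_range {T M : ModR R} {ι : Type*} (N : ι → ModR R)
    (f : ∀ i, N i →ₗ[Rᵐᵒᵖ] M) (hf : ⨆ i, LinearMap.range (f i) = ⊤)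
    (hN : ∀ i, Gen T (N i)) : Gen T M := by
  rw [gen_iff]
  refine eq_top_iff.2 (hf ▸ iSup_le fun i => ?_)
  rw [← Submodule.map_top, ← (gen_iff T (N i)).1 (hN i), Submodule.map_iSup]
  refine iSup_le fun g => ?_
  rw [← LinearMap.range_comp]
  exact le_iSup (fun h : T →ₗ[Rᵐᵒᵖ] M => LinearMap.range h) (f i ∘ₗ g)

lemma gen_of_surjective {T M N : ModR R} (f : M →ₗ[Rᵐᵒᵖ] N) (hf : Function.Surjective f)
    (h : Gen T M) : Gen T N :=
  gen_of_iSup_range (fun _ : Unit => M) (fun _ => f) (by simp [LinearMap.range_eq_top.2 hf])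
    fun _ => h

lemma gen_self (T : ModR R) : Gen T T :=
  (gen_iff T T).2 (eq_top_iff.2 fun m _ =>
    Submodule.mem_iSup_of_mem (LinearMap.id : T →ₗ[Rᵐᵒᵖ] T) ⟨m, rfl⟩)

lemma gen_directSum {T : ModR R} {I : Type u} (E : I → ModR R) (h : ∀ i, Gen T (E i)) :
    Gen T (ModuleCat.of Rᵐᵒᵖ (DirectSum I fun i => E i)) := by
  classical
  refine gen_of_iSup_range E (fun i => DirectSum.lof Rᵐᵒᵖ I (fun i => E i) i) ?_ h
  refine eq_top_iff.2 fun m _ => ?_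
  induction m using DirectSum.induction_on with
  | zero => simp
  | of i x => exact Submodule.mem_iSup_of_mem i ⟨x, rfl⟩
  | add x y hx hy => exact add_mem (hx trivial) (hy trivial)

lemma gen_finsupp {T M : ModR R} (I : Type u) (h : Gen T M) :
    Gen T (ModuleCat.of Rᵐᵒᵖ (I →₀ M)) := by
  classical
  exact gen_of_surjective (M := ModuleCat.of Rᵐᵒᵖ (DirectSum I fun _ => M))
    (finsuppLEquivDirectSum Rᵐᵒᵖ M I).symm.toLinearMap
    (finsuppLEquivDirectSum Rᵐᵒᵖ M I).symm.surjective (gen_directSum _ fun _ => h)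

lemma gen_prod {T M N : ModR R} (hM : Gen T M) (hN : Gen T N) :
    Gen T (ModuleCat.of Rᵐᵒᵖ (M × N)) := by
  refine gen_of_iSup_range (fun b : Bool => if b then M else N)
    (fun b => match b with
      | true => LinearMap.inl Rᵐᵒᵖ M N
      | false => LinearMap.inr Rᵐᵒᵖ M N) ?_ (by simp [hM, hN])
  rw [iSup_bool_eq]
  exact LinearMap.sup_range_inl_inr

lemma gen_trans {T U M : ModR R} (hU : Gen T U) (hM : Gen U M) : Gen T M := by
  obtain ⟨I, p, hp⟩ := hM
  exact gen_of_surjective (M := ModuleCat.of Rᵐᵒᵖ (I →₀ U)) p hp (gen_finsupp I hU)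

lemma Add_gen_le (T : ModR R) : Add (Gen T) ≤ Gen T := by
  rintro M ⟨I, E, N, hE, ⟨e⟩⟩
  exact gen_of_surjective (M := ModuleCat.of Rᵐᵒᵖ (DirectSum I fun i => E i))
    (LinearMap.fst Rᵐᵒᵖ M N ∘ₗ e.symm.toLinearMap)
    (Prod.fst_surjective.comp e.symm.surjective) (gen_directSum E hE)

lemma addOne_le {T : ModR R} {𝒞 : ObjectProperty (ModR R)} (h𝒞 : Add 𝒞 ≤ 𝒞) (hT : 𝒞 T) :
    AddOne T ≤ 𝒞 :=
  (Add_mono (by rintro E rfl; exact hT)).trans h𝒞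

lemma addOne_of_prod_equiv_finsupp {T M N : ModR R} (I : Type u)
    (e : (M × N) ≃ₗ[Rᵐᵒᵖ] (I →₀ T)) : AddOne T M := by
  classical
  exact ⟨I, fun _ => T, N, fun _ => rfl, ⟨e.trans (finsuppLEquivDirectSum Rᵐᵒᵖ T I)⟩⟩

lemma addOne_of_prod_equiv {T M N : ModR R} (e : (M × N) ≃ₗ[Rᵐᵒᵖ] T) : AddOne T M :=
  addOne_of_prod_equiv_finsupp PUnit (e.trans (Finsupp.uniqueLinearEquiv Rᵐᵒᵖ T PUnit.unit).symm)

variable (R) in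
/-- The right regular module is the left regular module of the opposite ring. -/
def regularEquiv : R ≃ₗ[Rᵐᵒᵖ] Rᵐᵒᵖ where
  __ := MulOpposite.opAddEquiv
  map_smul' := by intro a x; rfl

end Gen

lemma exists_linearEquiv_prod_ker {A M N : Type*} [Ring A] [AddCommGroup M] [Module A M]
    [AddCommGroup N] [Module A N] (p : M →ₗ[A] N) (s : N →ₗ[A] M) (h : p ∘ₗ s = LinearMap.id) :
    Nonempty ((N × LinearMap.ker p) ≃ₗ[A] M) := by
  have hs : ∀ n, p (s n) = n := fun n => congr($h n)
  refine ⟨LinearEquiv.ofBijective (s.coprod (LinearMap.ker p).subtype) ⟨?_, fun x => ?_⟩⟩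
  · rw [injective_iff_map_eq_zero]
    rintro ⟨n, k⟩ hnk
    have h0 : s n + k = 0 := by simpa using hnk
    have hn : n = 0 := by
      have := congr(p $h0)
      simpa [hs, LinearMap.mem_ker.1 k.2] using this
    subst hn
    simpa using h0
  · exact ⟨(p x, ⟨x - s (p x), by simp [hs]⟩), by simp⟩

/-! ### The identities for tilting modules, and tilting equivalence. -/

namespace IsOneTilting

variable {R : Type u} [Ring R] {T : ModR R} (hT : IsOneTilting T)

include hT

lemma gen_le_rightPerp : Gen T ≤ rightPerp T := by
  rintro M ⟨I, p, hp⟩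
  have := hT.projDim
  exact subsingleton_ext_quotient_target
    (shortExact_of_linearMap (L := ModuleCat.of _ (LinearMap.ker p)) (M := ModuleCat.of _ (I →₀ T))
      (ModuleCat.ofHom (LinearMap.ker p).subtype) (ModuleCat.ofHom p)
      Subtype.val_injective (LinearMap.exact_subtype_ker_map p) hp)
    (hT.ext_directSum I 1 one_pos) (HasProjectiveDimensionLT.subsingleton T 2 2 le_rfl _)

omit hT in
lemma addOne_le_leftPerp : AddOne T ≤ leftPerp (rightPerp T) :=
  addOne_le (Add_leftPerp_le _) fun _ h => h

omit hT in
lemma addOne_le_gen : AddOne T ≤ Gen T :=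
  addOne_le (Add_gen_le T) (gen_self T)

/-- If `Ext¹(T, M) = 0` then `Ext¹(T₁, M) = 0`, so each map `R → M` extends to `T₀`; thus every
element of `M` lies in the image of a map from `T₀`. -/
lemma gen_eq_rightPerp : Gen T = rightPerp T := by
  refine le_antisymm hT.gen_le_rightPerp fun M hM => ?_
  obtain ⟨T₀, T₁, f, g, h₀, h₁, hf, hfg, hg⟩ := hT.coresolution
  refine gen_of_iSup_range (fun _ : T₀ →ₗ[Rᵐᵒᵖ] M => T₀) (fun f => f) ?_
    fun _ => addOne_le_gen _ h₀
  refine eq_top_iff.2 fun m _ => ?_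
  obtain ⟨k, hk⟩ := exists_extension_of_ext
    (shortExact_of_linearMap (L := regular R) (ModuleCat.ofHom f) (ModuleCat.ofHom g) hf hfg hg)
    (addOne_le_leftPerp _ h₁ M hM)
    (ModuleCat.ofHom (LinearMap.toSpanSingleton Rᵐᵒᵖ M m ∘ₗ (regularEquiv R).toLinearMap))
  refine Submodule.mem_iSup_of_mem k.hom ⟨f 1, ?_⟩
  have := congr($hk (1 : R))
  simpa [regularEquiv] using this

/-- The canonical map onto `M` from the copies of `T` indexed by `Hom(T, M)` has kernel in `T^⊥ =
Gen T`, so it splits. -/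
lemma addOne_of_gen_of_leftPerp {M : ModR R} (hM : Gen T M) (hM' : leftPerp (Gen T) M) :
    AddOne T M := by
  let I := T →ₗ[Rᵐᵒᵖ] M
  let p : (I →₀ T) →ₗ[Rᵐᵒᵖ] M := Finsupp.lsum ℕ fun f => f
  have hp : Function.Surjective p := by
    refine LinearMap.range_eq_top.1 (eq_top_iff.2 ((gen_iff T M).1 hM ▸ iSup_le fun f => ?_))
    rintro _ ⟨t, rfl⟩
    exact ⟨Finsupp.single f t, by simp [p]⟩
  have hS := shortExact_of_linearMap (L := ModuleCat.of _ (LinearMap.ker p))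
    (M := ModuleCat.of _ (I →₀ T)) (ModuleCat.ofHom (LinearMap.ker p).subtype)
    (ModuleCat.ofHom p) Subtype.val_injective (LinearMap.exact_subtype_ker_map p) hp
  have hK : Gen T (ModuleCat.of _ (LinearMap.ker p)) := by
    rw [hT.gen_eq_rightPerp]
    refine subsingleton_ext_of_lifts hS (hT.ext_directSum I 1 one_pos) fun f => ?_
    -- The map `f` is itself an index, and the inclusion of its coordinate lifts it.
    refine ⟨ModuleCat.ofHom (Finsupp.lsingle (f.hom : I)), ?_⟩
    ext x
    simp [p]
  obtain ⟨s, hs⟩ := exists_lift_of_ext hS (hM' _ hK) (𝟙 M)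
  obtain ⟨e⟩ := exists_linearEquiv_prod_ker p s.hom (by simpa using congr(($hs).hom))
  exact addOne_of_prod_equiv_finsupp (N := ModuleCat.of _ (LinearMap.ker p)) I e

lemma gen_inf_leftPerp_eq : Gen T ⊓ leftPerp (Gen T) = AddOne T := by
  refine le_antisymm (fun M hM => hT.addOne_of_gen_of_leftPerp hM.1 hM.2) (le_inf ?_ ?_)
  · exact addOne_le_gen
  · rw [hT.gen_eq_rightPerp]; exact addOne_le_leftPerp

lemma of_gen_of_leftPerp {U : ModR R} (hU : Gen T U) (hU' : leftPerp (Gen T) U)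
    (hc : ∃ (U₀ U₁ : ModR R) (f : R →ₗ[Rᵐᵒᵖ] U₀) (g : U₀ →ₗ[Rᵐᵒᵖ] U₁),
      AddOne U U₀ ∧ AddOne U U₁ ∧
        Function.Injective f ∧ Function.Exact f g ∧ Function.Surjective g) :
    IsOneTilting U := by
  -- `Gen T` contains the injectives and is closed under quotients, so every cosyzygy `Q` lies in
  -- it, and dimension shifting gives `Ext²(U, Y) = 0`.
  have hpd : HasProjectiveDimensionLE U 1 := by
    refine hasProjectiveDimensionLT_of_enoughInjectives U 2 fun Y => ?_
    obtain ⟨J, Q, f, g, hJ, hf, hfg, hg⟩ := exists_injective_presentation Y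
    refine subsingleton_ext_succ_kernel_target (shortExact_of_linearMap f g hf hfg hg)
      (hU' Q (gen_of_surjective g.hom hg ?_)) (Ext.subsingleton_of_injective _ _ 1)
    rw [hT.gen_eq_rightPerp]
    exact Ext.subsingleton_of_injective _ _ 0
  refine ⟨hpd, fun I i hi => ?_, hc⟩
  obtain rfl | hi : i = 1 ∨ 2 ≤ i := by omega
  · exact hU' _ (gen_finsupp I hU)
  · exact HasProjectiveDimensionLT.subsingleton U 2 i hi _

lemma tiltingEquivalent_of_gen_of_leftPerp {U : ModR R} (hUt : IsOneTilting U) (hU : Gen T U)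
    (hU' : leftPerp (Gen T) U) : TiltingEquivalent T U := by
  refine le_antisymm (fun M hM => ?_) ?_
  · rw [← hT.gen_eq_rightPerp] at hM
    exact hU' M hM
  · rw [← hT.gen_eq_rightPerp, ← hUt.gen_eq_rightPerp]
    exact fun M hM => gen_trans hU hM

end IsOneTilting

end Tilting

namespace Tilting

open CategoryTheory Limits

/-! ### Finitely presented modules as finitely presentable objects. -/

section

variable {A : Type u} [Ring A]

attribute [local instance] Cardinal.fact_isRegular_aleph0

/-- `Hom(A, -)` is the forgetful functor, which preserves filtered colimits. -/
lemma isFinitelyPresentable_self : IsFinitelyPresentable.{u} (ModuleCat.of A A) := by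
  rw [isFinitelyPresentable_iff_preservesFilteredColimits]
  let e : coyoneda.obj (Opposite.op (ModuleCat.of A A)) ≅ forget (ModuleCat.{u} A) :=
    NatIso.ofComponents (fun M => Equiv.toIso
      (ModuleCat.homEquiv.trans (LinearMap.ringLmapEquivSelf A ℕ M).toEquiv))
      (by intro M N f; ext g; simp [ModuleCat.homEquiv])
  exact ⟨fun J _ _ => preservesColimitsOfShape_of_natIso e.symm⟩

lemma isFinitelyPresentable_of_exact {L M N : ModuleCat.{u} A} (f : L ⟶ M) (g : M ⟶ N)
    (hfg : Function.Exact f g) (hg : Function.Surjective g)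
    (hL : IsFinitelyPresentable.{u} L) (hM : IsFinitelyPresentable.{u} M) :
    IsFinitelyPresentable.{u} N := by
  let S := ShortComplex.mk f g (by ext x; exact hfg.apply_apply_eq_zero x)
  have hS : S.Exact := (ShortComplex.ShortExact.moduleCat_exact_iff_function_exact _).2 hfg
  have : Epi S.g := (ModuleCat.epi_iff_surjective _).2 hg
  have (k : WalkingParallelPair) :
      IsCardinalPresentable ((parallelPair S.f 0).obj k) Cardinal.aleph0.{u} := by
    rcases k with _ | _
    · exact hL
    · exact hM
  exact isCardinalPresentable_of_isColimit _ hS.gIsCokernel Cardinal.aleph0.{u}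
    (by rw [hasCardinalLT_aleph0_iff]; infer_instance)

lemma isFinitelyPresentable_fin_fun (n : ℕ) :
    IsFinitelyPresentable.{u} (ModuleCat.of A (Fin n → A)) := by
  have hA := isFinitelyPresentable_self (A := A)
  have : HasFiniteBiproducts (ModuleCat.{u} A) := Abelian.hasFiniteBiproducts
  let F : Fin n → ModuleCat.{u} A := fun _ => ModuleCat.of A A
  have (k : Discrete (Fin n)) :
      IsCardinalPresentable ((Discrete.functor F).obj k) Cardinal.aleph0.{u} := hA
  have : IsCardinalPresentable (⨁ F) Cardinal.aleph0.{u} :=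
    isCardinalPresentable_of_isColimit _ (biproduct.isColimit F) Cardinal.aleph0.{u}
      (by rw [hasCardinalLT_aleph0_iff]; infer_instance)
  exact isCardinalPresentable_of_iso (ModuleCat.biproductIsoPi F) _

lemma isFinitelyPresentable_of_finitePresentation (M : ModuleCat.{u} A)
    [Module.FinitePresentation A M] : IsFinitelyPresentable.{u} M := by
  obtain ⟨n, m, f, g, hf, hfg⟩ : ∃ (n m : ℕ) (f : (Fin n → A) →ₗ[A] M)
      (g : (Fin m → A) →ₗ[A] (Fin n → A)), Function.Surjective f ∧ Function.Exact g f := by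
    obtain ⟨n, f, hf⟩ := Module.Finite.exists_fin' A M
    have : Module.Finite A (LinearMap.ker f) :=
      Module.Finite.iff_fg.2 (Module.FinitePresentation.fg_ker f hf)
    obtain ⟨m, g, hg⟩ := Module.Finite.exists_fin' A (LinearMap.ker f)
    refine ⟨n, m, f, (LinearMap.ker f).subtype ∘ₗ g, hf, LinearMap.exact_iff.2 ?_⟩
    rw [LinearMap.range_comp, LinearMap.range_eq_top.2 hg, Submodule.map_top,
      Submodule.range_subtype]
  exact isFinitelyPresentable_of_exact (ModuleCat.ofHom g) (ModuleCat.ofHom f) hfg hf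
    (isFinitelyPresentable_fin_fun m) (isFinitelyPresentable_fin_fun n)

lemma isStrongGenerator_singleton_self :
    (ObjectProperty.singleton (ModuleCat.of A A)).IsStrongGenerator := by
  rw [ObjectProperty.isStrongGenerator_iff]
  refine ⟨fun X Y f g h => ?_, fun X Y i hi h => ?_⟩
  · ext x
    have := congr($(h _ (by simp) (ModuleCat.ofHom (LinearMap.toSpanSingleton A X x))) (1 : A))
    simpa using this
  · have : Epi i := by
      refine (ModuleCat.epi_iff_surjective _).2 fun y => ?_
      obtain ⟨f, hf⟩ := h _ (by simp) (ModuleCat.ofHom (LinearMap.toSpanSingleton A Y y))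
      exact ⟨f (1 : A), by simpa using congr($hf (1 : A))⟩
    exact isIso_of_mono_of_epi i

instance : IsFinitelyAccessibleCategory.{u} (ModuleCat.{u} A) := by
  have : IsLocallyFinitelyPresentable.{u} (ModuleCat.{u} A) := by
    refine (IsCardinalLocallyPresentable.iff_exists_isStrongGenerator _ _).2
      ⟨_, ?_, isStrongGenerator_singleton_self (A := A), ?_⟩
    · infer_instance
    · rintro X hX
      obtain rfl : ModuleCat.of A A = X := by simpa using hX
      exact isFinitelyPresentable_self
  infer_instance

/-- The class of finitely presented modules. -/
def finitelyPresentedModules (A : Type u) [Ring A] : ObjectProperty (ModuleCat.{u} A) :=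
  fun M => Module.FinitePresentation A M

instance : (finitelyPresentedModules A).IsClosedUnderIsomorphisms where
  of_iso e h := by
    have : Module.FinitePresentation A _ := h
    exact Module.FinitePresentation.of_equiv e.toLinearEquiv

/-- A finite colimit is the product of the objects modulo one finitely generated submodule of
relations per arrow. -/
lemma finitePresentation_of_isColimit {J : Type u} [SmallCategory J] [Finite (Arrow J)]
    {F : J ⥤ ModuleCat.{u} A} {c : Cocone F} (hc : IsColimit c)
    (hF : ∀ j, Module.FinitePresentation A (F.obj j)) :
    Module.FinitePresentation A c.pt := by
  classical
  have : Finite J := Finite.of_injective (fun j => Arrow.mk (𝟙 j)) fun i j h => congr($(h).left)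
  have := Fintype.ofFinite J
  let P := ∀ j, F.obj j
  let K : Arrow J → Submodule A P := fun a => LinearMap.range
    (LinearMap.single A (fun j => F.obj j) a.right ∘ₗ (F.map a.hom).hom -
      LinearMap.single A (fun j => F.obj j) a.left)
  have hK : (⨆ a, K a).FG := Submodule.fg_iSup _ fun a => by
    have : Module.Finite A (F.obj a.left) := inferInstance
    dsimp only [K]
    rw [← Submodule.map_top]
    exact Submodule.FG.map _ (Module.finite_def.1 this)
  let Q := ModuleCat.of A (P ⧸ ⨆ a, K a)
  have hQ : Module.FinitePresentation A Q :=
    Module.finitePresentation_of_surjective (Submodule.mkQ (⨆ a, K a)) (Submodule.mkQ_surjective _)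
      (by rwa [Submodule.ker_mkQ])
  let d : Cocone F :=
    { pt := Q
      ι :=
        { app j := ModuleCat.ofHom
            (Submodule.mkQ (⨆ a, K a) ∘ₗ LinearMap.single A (fun j => F.obj j) j)
          naturality i j f := by
            ext x
            refine (Submodule.Quotient.eq _).2 (Submodule.mem_iSup_of_mem (Arrow.mk f) ?_)
            exact ⟨x, rfl⟩ } }
  let p : P →ₗ[A] c.pt := LinearMap.lsum A (fun j => F.obj j) ℕ fun j => (c.ι.app j).hom
  have hp : ∀ j, p ∘ₗ LinearMap.single A (fun j => F.obj j) j = (c.ι.app j).hom := fun j => by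
    ext x
    exact LinearMap.lsum_piSingle (M := c.pt) A (fun j => F.obj j) ℕ (fun j => (c.ι.app j).hom) j x
  let b : Q ⟶ c.pt := ModuleCat.ofHom (Submodule.liftQ _ p (iSup_le fun a => by
    rintro _ ⟨x, rfl⟩
    have h₁ := congr($(hp a.right) (F.map a.hom x))
    have h₂ := congr($(hp a.left) x)
    have h₃ := congr($(c.w a.hom) x)
    simp only [LinearMap.comp_apply] at h₁ h₂
    simp only [ModuleCat.hom_comp, LinearMap.comp_apply] at h₃
    simp only [LinearMap.mem_ker, LinearMap.sub_apply, LinearMap.comp_apply, map_sub]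
    rw [sub_eq_zero]
    exact h₁.trans (h₃.trans h₂.symm)))
  let a : c.pt ⟶ Q := hc.desc d
  have ha : ∀ j, c.ι.app j ≫ a = d.ι.app j := hc.fac d
  have hb : ∀ j, d.ι.app j ≫ b = c.ι.app j := fun j => by
    ext x
    exact congr($(hp j) x)
  have hab : a ≫ b = 𝟙 _ := hc.hom_ext fun j => by
    rw [← Category.assoc, ha, hb, Category.comp_id]
  have hba : b ≫ a = 𝟙 _ := by
    ext : 1
    refine Submodule.linearMap_qext _ (LinearMap.pi_ext' fun j => ?_)
    have : d.ι.app j ≫ b ≫ a = d.ι.app j := by rw [← Category.assoc, hb, ha]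
    exact congr(($this).hom)
  exact Module.FinitePresentation.of_equiv (Iso.mk b a hba hab).toLinearEquiv

/-- Presentable objects are the closure of `A` under finite colimits, and finite presentation
survives these. -/
lemma finitePresentation_of_isFinitelyPresentable (M : ModuleCat.{u} A)
    [h : IsFinitelyPresentable.{u} M] : Module.FinitePresentation A M := by
  have h₁ : ObjectProperty.singleton (ModuleCat.of A A) ≤
      isCardinalPresentable (ModuleCat.{u} A) Cardinal.aleph0.{u} := by
    rintro X hX
    obtain rfl : ModuleCat.of A A = X := by simpa using hX
    exact isFinitelyPresentable_self
  have h₂ := IsStrongGenerator.colimitsCardinalClosure_eq_isCardinalPresentable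
    isStrongGenerator_singleton_self h₁
  have h₃ : isCardinalPresentable (ModuleCat.{u} A) Cardinal.aleph0.{u} M := h
  rw [h₂] at h₃
  refine ObjectProperty.colimitsCardinalClosure_le (Q := finitelyPresentedModules A) _ _
    (fun J _ hJ => ⟨?_⟩) ?_ M h₃
  · rintro X ⟨hX⟩
    rw [hasCardinalLT_aleph0_iff] at hJ
    exact finitePresentation_of_isColimit hX.isColimit hX.prop_diag_obj
  · rintro X hX
    obtain rfl : ModuleCat.of A A = X := by simpa using hX
    exact (inferInstance : Module.FinitePresentation A A)

end

/-! ### Direct limits of finitely presented modules. -/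

section

variable {R : Type u} [Ring R]

lemma directLimits_of_factorization {𝒳 : ObjectProperty (ModR R)} (h𝒳 : 𝒳 ≤ finPres R) {M : ModR R}
    (h : ∀ (A : ModR R) (f : A ⟶ M), finPres R A →
      ∃ (X : ModR R) (a : A ⟶ X) (b : X ⟶ M), a ≫ b = f ∧ 𝒳 X) : directLimits 𝒳 M := by
  have h₁ : 𝒳 ≤ ObjectProperty.isFinitelyPresentable.{u} (ModR R) := fun X hX =>
    have : Module.FinitePresentation Rᵐᵒᵖ X := h𝒳 X hX
    isFinitelyPresentable_of_finitePresentation X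
  obtain ⟨J, _, _, p, hp⟩ := (ObjectProperty.ind_iff_exists h₁ (X := M)).2 fun {Z} g _ =>
    h Z g (finitePresentation_of_isFinitelyPresentable Z)
  obtain ⟨I, _, _, _, F, _⟩ := IsFiltered.exists_directed J
  exact ⟨I, inferInstance, inferInstance, inferInstance,
    ⟨ObjectProperty.ColimitOfShape.reindex ⟨p, hp⟩ F⟩⟩

lemma gen_of_directLimits {T : ModR R} {𝒳 : ObjectProperty (ModR R)} (h𝒳 : 𝒳 ≤ Gen T) :
    directLimits 𝒳 ≤ Gen T := by
  rintro M ⟨I, _, _, _, ⟨p⟩⟩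
  refine gen_of_iSup_range (fun i => p.diag.obj i) (fun i => (p.ι.app i).hom) ?_
    fun i => h𝒳 _ (p.prop_diag_obj i)
  let K : Submodule Rᵐᵒᵖ M := ⨆ i, LinearMap.range (p.ι.app i).hom
  -- The quotient by the sum of the images kills every leg of the colimit, hence is zero.
  have : ModuleCat.ofHom (Submodule.mkQ K) = 0 := p.isColimit.hom_ext fun i => by
    ext x
    refine (Submodule.Quotient.mk_eq_zero _).2 (Submodule.mem_iSup_of_mem i ⟨x, rfl⟩)
  refine eq_top_iff.2 fun m _ => (Submodule.Quotient.mk_eq_zero K).1 ?_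
  exact congr($this m)

end

end Tilting

namespace Tilting

open CategoryTheory

/-! ### Finitely presented special preenvelopes. -/

section

variable {R : Type u} [Ring R]

/-- The map is determined by `f 1`, whose support is finite. -/
lemma exists_finite_retract_of_hom_directSum {I : Type u} (E : I → ModR R)
    (f : R →ₗ[Rᵐᵒᵖ] DirectSum I fun i => E i) :
    ∃ (s : Finset I) (j : (∀ i : s, E i) →ₗ[Rᵐᵒᵖ] DirectSum I fun i => E i)
      (q : (DirectSum I fun i => E i) →ₗ[Rᵐᵒᵖ] ∀ i : s, E i),
      q ∘ₗ j = LinearMap.id ∧ j ∘ₗ q ∘ₗ f = f := by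
  classical
  let s := DFinsupp.support (f 1)
  let j : (∀ i : s, E i) →ₗ[Rᵐᵒᵖ] DirectSum I fun i => E i :=
    LinearMap.lsum Rᵐᵒᵖ (fun i : s => E i) ℕ fun i => DirectSum.lof Rᵐᵒᵖ I (fun i => E i) i
  let q : (DirectSum I fun i => E i) →ₗ[Rᵐᵒᵖ] ∀ i : s, E i :=
    LinearMap.pi fun i => DirectSum.component Rᵐᵒᵖ I (fun i => E i) i
  refine ⟨s, j, q, ?_, ?_⟩
  · refine LinearMap.pi_ext fun i x => funext fun k => ?_
    have h : j (Pi.single i x) = DirectSum.lof Rᵐᵒᵖ I (fun i => E i) i x :=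
      LinearMap.lsum_piSingle Rᵐᵒᵖ (fun i : s => E i) ℕ
        (fun i : s => DirectSum.lof Rᵐᵒᵖ I (fun i => E i) i) i x
    simp only [LinearMap.comp_apply, h, q, LinearMap.pi_apply, LinearMap.id_apply]
    obtain rfl | hik := eq_or_ne i k
    · rw [DirectSum.component.lof_self, Pi.single_eq_same]
    · rw [DirectSum.component.of, dif_neg (fun h => hik (Subtype.ext h)),
        Pi.single_eq_of_ne hik.symm]
  · have h1 : j (q (f 1)) = f 1 := by
      conv_rhs => rw [← DirectSum.sum_support_of (f 1)]
      rw [← Finset.sum_coe_sort]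
      simp [j, q, LinearMap.lsum_apply, DirectSum.lof_eq_of, DirectSum.component, s]
      rfl
    refine LinearMap.ext fun r => ?_
    have hr : r = MulOpposite.op r • (1 : R) := by simp
    rw [hr]
    simp only [LinearMap.comp_apply, map_smul, h1]

lemma leftPerp_quotient_of_retract {𝒞 : ObjectProperty (ModR R)} {X D : ModR R}
    (j : X →ₗ[Rᵐᵒᵖ] D) (q : D →ₗ[Rᵐᵒᵖ] X) (hqj : q ∘ₗ j = LinearMap.id)
    (K : Submodule Rᵐᵒᵖ X) (L : Submodule Rᵐᵒᵖ D) (hK : K ≤ L.comap j) (hL : L ≤ K.comap q)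
    (h : leftPerp 𝒞 (ModuleCat.of Rᵐᵒᵖ (D ⧸ L))) :
    leftPerp 𝒞 (ModuleCat.of Rᵐᵒᵖ (X ⧸ K)) := by
  refine leftPerp_of_retract (N := ModuleCat.of Rᵐᵒᵖ (D ⧸ L)) (K.mapQ L j hK) (L.mapQ K q hL)
    (Submodule.linearMap_qext _ (LinearMap.ext fun x => ?_)) h
  simpa using congr(Submodule.Quotient.mk (p := K) ($hqj x))

lemma leftPerp_prod {𝒞 : ObjectProperty (ModR R)} {M N : ModR R} (hM : leftPerp 𝒞 M)
    (hN : leftPerp 𝒞 N) : leftPerp 𝒞 (ModuleCat.of Rᵐᵒᵖ (M × N)) :=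
  leftPerp_of_exact (M := ModuleCat.of Rᵐᵒᵖ (M × N)) (ModuleCat.ofHom (LinearMap.inl Rᵐᵒᵖ M N))
    (ModuleCat.ofHom (LinearMap.snd Rᵐᵒᵖ M N)) LinearMap.inl_injective
    Function.Exact.inl_snd Prod.snd_surjective hM hN

/-- A finite power as a direct sum indexed by a type in the universe of the ring. -/
noncomputable def finPowEquivDirectSum (n : ℕ) (M : ModR R) :
    (Fin n → M) ≃ₗ[Rᵐᵒᵖ] DirectSum (ULift.{u} (Fin n)) fun _ => M := by
  classical
  exact (LinearEquiv.funCongrLeft Rᵐᵒᵖ M Equiv.ulift).trans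
    ((Finsupp.linearEquivFunOnFinite Rᵐᵒᵖ M (ULift.{u} (Fin n))).symm.trans
      (finsuppLEquivDirectSum Rᵐᵒᵖ M (ULift.{u} (Fin n))))

lemma gen_fin_fun {T M : ModR R} (n : ℕ) (h : Gen T M) :
    Gen T (ModuleCat.of Rᵐᵒᵖ (Fin n → M)) :=
  gen_of_surjective (M := ModuleCat.of Rᵐᵒᵖ (DirectSum (ULift.{u} (Fin n)) fun _ => M))
    (finPowEquivDirectSum n M).symm.toLinearMap (finPowEquivDirectSum n M).symm.surjective
    (gen_directSum _ fun _ => h)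

lemma leftPerp_fin_fun {𝒞 : ObjectProperty (ModR R)} {M : ModR R} (n : ℕ) (h : leftPerp 𝒞 M) :
    leftPerp 𝒞 (ModuleCat.of Rᵐᵒᵖ (Fin n → M)) :=
  leftPerp_of_linearEquiv
    (N := ModuleCat.of Rᵐᵒᵖ (DirectSum (ULift.{u} (Fin n)) fun _ => M))
    (finPowEquivDirectSum n M) (leftPerp_directSum _ fun _ => h)

/-- The pushout of a special preenvelope along an epimorphism. -/
lemma isSpecialPreenvelope_pushout {T P A X D : ModR R} (p : P →ₗ[Rᵐᵒᵖ] A)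
    (hp : Function.Surjective p) (φ : P →ₗ[Rᵐᵒᵖ] X) (π : X →ₗ[Rᵐᵒᵖ] D)
    (hφ : Function.Injective φ) (hφπ : Function.Exact φ π) (hπ : Function.Surjective π)
    (hX : Gen T X) (hD : leftPerp (Gen T) D) :
    ∃ ψ : A ⟶ ModuleCat.of Rᵐᵒᵖ (X ⧸ (LinearMap.ker p).map φ),
      IsSpecialPreenvelope (Gen T) ψ := by
  let K := (LinearMap.ker p).map φ
  let ψ : A →ₗ[Rᵐᵒᵖ] (X ⧸ K) :=
    (LinearMap.ker p).mapQ K φ (Submodule.le_comap_map _ _) ∘ₗ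
      (p.quotKerEquivOfSurjective hp).symm.toLinearMap
  have hψ : ∀ x, ψ (p x) = Submodule.Quotient.mk (φ x) := fun x => by
    have : (p.quotKerEquivOfSurjective hp).symm (p x) = Submodule.Quotient.mk x := by
      rw [LinearEquiv.symm_apply_eq]; rfl
    simp [ψ, this]
  -- The pushout leaves the cokernel `D` unchanged.
  let γ : (X ⧸ K) →ₗ[Rᵐᵒᵖ] D := K.liftQ π (by
    rintro _ ⟨x, -, rfl⟩
    exact hφπ.apply_apply_eq_zero x)
  refine ⟨ModuleCat.ofHom ψ, isSpecialPreenvelope_of_exact (ModuleCat.ofHom ψ)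
    (ModuleCat.ofHom (Y := D) γ) ?_ ?_ ?_
    (gen_of_surjective K.mkQ K.mkQ_surjective hX) hD⟩
  · refine (injective_iff_map_eq_zero ψ).2 fun a ha => ?_
    obtain ⟨x, rfl⟩ := hp a
    rw [hψ, Submodule.Quotient.mk_eq_zero] at ha
    obtain ⟨y, hy, hyx⟩ := ha
    exact hφ hyx ▸ hy
  · intro y
    obtain ⟨y, rfl⟩ := K.mkQ_surjective y
    refine (hφπ y).trans ⟨?_, ?_⟩
    · rintro ⟨x, rfl⟩
      exact ⟨p x, hψ x⟩
    · rintro ⟨a, ha⟩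
      obtain ⟨x, rfl⟩ := hp a
      have hxy : (Submodule.Quotient.mk (φ x) : X ⧸ K) = Submodule.Quotient.mk y :=
        (hψ x).symm.trans ha
      obtain ⟨z, -, hz⟩ := (Submodule.Quotient.eq K).1 hxy
      exact ⟨x - z, by rw [map_sub, hz, sub_sub_cancel]⟩
  · exact fun d => (hπ d).elim fun x hx => ⟨Submodule.Quotient.mk x, hx⟩

lemma exists_finPres_specialPreenvelope_regular {T : ModR R} (hT : IsOneTilting T)
    (h : Gen T ⊓ leftPerp (Gen T) ≤ Add (Gen T ⊓ leftPerp (Gen T) ⊓ finPres R)) :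
    ∃ (C : ModR R) (φ : regular R ⟶ C), IsSpecialPreenvelope (Gen T) φ ∧ finPres R C := by
  obtain ⟨T₀, T₁, f, g, h₀, h₁, hf, hfg, hg⟩ := hT.coresolution
  rw [← hT.gen_inf_leftPerp_eq] at h₀ h₁
  obtain ⟨I, E, N, hE, ⟨e⟩⟩ := h T₀ h₀
  let D := ModuleCat.of Rᵐᵒᵖ (DirectSum I fun i => E i)
  have hD : leftPerp (Gen T) D := leftPerp_directSum E fun i => (hE i).1.2
  have hN : leftPerp (Gen T) N := leftPerp_of_retract (N := D)
    (e.toLinearMap ∘ₗ LinearMap.inr Rᵐᵒᵖ T₀ N) (LinearMap.snd Rᵐᵒᵖ T₀ N ∘ₗ e.symm.toLinearMap)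
    (by ext; simp) hD
  -- Adding `N` to both `T₀` and `T₁` gives an exact sequence `0 → R → D → T₁ ⊕ N → 0`.
  let F : R →ₗ[Rᵐᵒᵖ] D := e.toLinearMap ∘ₗ LinearMap.inl Rᵐᵒᵖ T₀ N ∘ₗ f
  let G : D →ₗ[Rᵐᵒᵖ] (T₁ × N) := g.prodMap LinearMap.id ∘ₗ e.symm.toLinearMap
  have hFG : Function.Exact F G := by
    intro y
    obtain ⟨⟨t, n⟩, rfl⟩ := e.surjective y
    have : G (e (t, n)) = (g t, n) := by simp [G]
    rw [this, Prod.mk_eq_zero, hfg t]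
    constructor
    · rintro ⟨⟨r, rfl⟩, rfl⟩
      exact ⟨r, rfl⟩
    · rintro ⟨r, hr⟩
      have : (f r, (0 : N)) = (t, n) := e.injective hr
      exact ⟨⟨r, congr($(this).1)⟩, congr($(this).2).symm⟩
  have hG : Function.Surjective G :=
    (Prod.map_surjective.2 ⟨hg, Function.surjective_id⟩).comp e.symm.surjective
  have hDF : leftPerp (Gen T) (ModuleCat.of Rᵐᵒᵖ (D ⧸ LinearMap.range F)) :=
    leftPerp_of_linearEquiv (N := ModuleCat.of Rᵐᵒᵖ (T₁ × N)) (hFG.linearEquivOfSurjective hG)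
      (leftPerp_prod h₁.2 hN)
  obtain ⟨s, j, q, hqj, hjq⟩ := exists_finite_retract_of_hom_directSum E F
  let X := ModuleCat.of Rᵐᵒᵖ (∀ i : s, E i)
  have hX : finPres R X := by
    have (i : s) : Module.FinitePresentation Rᵐᵒᵖ (E i) := (hE i).2
    exact inferInstanceAs (Module.FinitePresentation Rᵐᵒᵖ (∀ i : s, E i))
  have hXT : Gen T X := gen_of_surjective (M := D) q
    (fun x => ⟨j x, congr($hqj x)⟩) (gen_directSum E fun i => (hE i).1.1)
  let φ : R →ₗ[Rᵐᵒᵖ] X := q ∘ₗ F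
  have hφj : ∀ r, j (φ r) = F r := fun r => congr($hjq r)
  have hφ : Function.Injective φ := by
    have hF : Function.Injective F :=
      e.injective.comp (LinearMap.inl_injective.comp hf)
    exact fun a b hab => hF (by rw [← hφj, hab, hφj])
  refine ⟨X, ModuleCat.ofHom φ, isSpecialPreenvelope_of_exact (L := regular R)
    (N := ModuleCat.of Rᵐᵒᵖ (X ⧸ LinearMap.range φ)) (ModuleCat.ofHom φ)
    (ModuleCat.ofHom (Submodule.mkQ _)) hφ (LinearMap.exact_map_mkQ_range φ)
    (Submodule.mkQ_surjective _) hXT ?_, hX⟩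
  refine leftPerp_quotient_of_retract (D := D) j q hqj _ (LinearMap.range F) ?_ ?_ hDF
  · rintro _ ⟨r, rfl⟩
    exact ⟨r, (hφj r).symm⟩
  · rintro _ ⟨r, rfl⟩
    exact ⟨r, rfl⟩

/-- Push the `n`-th power of `φ` out along an epimorphism `Rⁿ → A`. Its kernel is finitely
generated, so the pushout remains finitely presented. -/
lemma exists_finPres_specialPreenvelope {T C : ModR R} {φ : regular R ⟶ C}
    (hφ : IsSpecialPreenvelope (Gen T) φ) (hC : finPres R C) (A : ModR R) (hA : finPres R A) :
    ∃ (B : ModR R) (ψ : A ⟶ B), IsSpecialPreenvelope (Gen T) ψ ∧ finPres R B := by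
  obtain ⟨hinj, hperp⟩ := hφ.exists_exact
  have : Module.FinitePresentation Rᵐᵒᵖ A := hA
  have : Module.FinitePresentation Rᵐᵒᵖ C := hC
  obtain ⟨n, p, hp⟩ := Module.Finite.exists_fin' Rᵐᵒᵖ A
  let Φ : (Fin n → Rᵐᵒᵖ) →ₗ[Rᵐᵒᵖ] (Fin n → C) :=
    (φ.hom ∘ₗ (regularEquiv R).symm.toLinearMap).compLeft (Fin n)
  let ρ : (Fin n → C) →ₗ[Rᵐᵒᵖ] (Fin n → (C ⧸ LinearMap.range φ.hom)) :=
    (Submodule.mkQ _).compLeft (Fin n)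
  have hΦ : Function.Injective Φ := fun a b hab => funext fun i =>
    (regularEquiv R).symm.injective (hinj congr($hab i))
  have hρ : Function.Surjective ρ := fun y => by
    choose x hx using fun i => Submodule.mkQ_surjective _ (y i)
    exact ⟨x, funext hx⟩
  have hex : Function.Exact Φ ρ := by
    intro y
    constructor
    · intro h
      choose r hr using fun i => (Submodule.Quotient.mk_eq_zero _).1 congr($h i)
      exact ⟨fun i => regularEquiv R (r i), funext fun i => by simp [Φ, hr]⟩
    · rintro ⟨x, rfl⟩
      exact funext fun i => (Submodule.Quotient.mk_eq_zero _).2 ⟨_, rfl⟩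
  obtain ⟨ψ, hψ⟩ := isSpecialPreenvelope_pushout (P := ModuleCat.of Rᵐᵒᵖ (Fin n → Rᵐᵒᵖ))
    (X := ModuleCat.of Rᵐᵒᵖ (Fin n → C))
    (D := ModuleCat.of Rᵐᵒᵖ (Fin n → (C ⧸ LinearMap.range φ.hom))) p hp Φ ρ hΦ hex hρ
    (gen_fin_fun n hφ.1.1)
    (leftPerp_fin_fun (M := ModuleCat.of Rᵐᵒᵖ (C ⧸ LinearMap.range φ.hom)) n hperp)
  refine ⟨_, ψ, hψ, ?_⟩
  exact Module.finitePresentation_of_surjective (Submodule.mkQ _) (Submodule.mkQ_surjective _)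
    (by
      rw [Submodule.ker_mkQ]
      exact Submodule.FG.map _ (Module.FinitePresentation.fg_ker p hp))

lemma IsSpecialPreenvelope.leftPerp {𝒞 : ObjectProperty (ModR R)} {A C : ModR R} {φ : A ⟶ C}
    (hφ : IsSpecialPreenvelope 𝒞 φ) (hA : leftPerp 𝒞 A) : leftPerp 𝒞 C := by
  obtain ⟨hinj, hperp⟩ := hφ.exists_exact
  exact leftPerp_of_exact φ (ModuleCat.ofHom (Submodule.mkQ _)) hinj
    (LinearMap.exact_map_mkQ_range φ.hom) (Submodule.mkQ_surjective _) hA hperp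

lemma finPres_regular : finPres R (regular R) :=
  Module.FinitePresentation.of_equiv (regularEquiv R).symm

lemma leftPerp_regular (𝒞 : ObjectProperty (ModR R)) : leftPerp 𝒞 (regular R) :=
  have : Module.Projective Rᵐᵒᵖ (regular R) := Module.Projective.of_equiv (regularEquiv R).symm
  leftPerp_of_projective 𝒞 (regular R)

/-- Since `R` is projective, `C` is an extension of modules in `^⊥(Gen T)`; hence `C ⊕ C/R` lies in
`Gen T ∩ ^⊥(Gen T)`, and `0 → R → C → C/R → 0` is its coresolution. -/
lemma isClassical_of_specialPreenvelope_regular {T C : ModR R} (hT : IsOneTilting T)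
    {φ : regular R ⟶ C} (hφ : IsSpecialPreenvelope (Gen T) φ) (hC : finPres R C) :
    IsClassical T := by
  have hC' := hφ.leftPerp (leftPerp_regular _)
  obtain ⟨hinj, hperp⟩ := hφ.exists_exact
  let D := ModuleCat.of Rᵐᵒᵖ (C ⧸ LinearMap.range φ.hom)
  let U := ModuleCat.of Rᵐᵒᵖ (C × D)
  have hU : Gen T U :=
    gen_prod hφ.1.1 (gen_of_surjective (Submodule.mkQ _) (Submodule.mkQ_surjective _) hφ.1.1)
  have hU' : leftPerp (Gen T) U := leftPerp_prod hC' hperp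
  have hUt : IsOneTilting U := hT.of_gen_of_leftPerp hU hU'
    ⟨C, D, φ.hom, Submodule.mkQ _, addOne_of_prod_equiv (N := D) (LinearEquiv.refl Rᵐᵒᵖ (C × D)),
      addOne_of_prod_equiv (N := C) (LinearEquiv.prodComm Rᵐᵒᵖ D C), hinj,
      LinearMap.exact_map_mkQ_range φ.hom, Submodule.mkQ_surjective _⟩
  refine ⟨hT, U, hUt, ?_, hT.tiltingEquivalent_of_gen_of_leftPerp hUt hU hU'⟩
  have : Module.FinitePresentation Rᵐᵒᵖ C := hC
  have : Module.FinitePresentation Rᵐᵒᵖ (regular R) := finPres_regular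
  have : Module.FinitePresentation Rᵐᵒᵖ D :=
    Module.finitePresentation_of_surjective (Submodule.mkQ _) (Submodule.mkQ_surjective _) (by
      rw [Submodule.ker_mkQ, ← Submodule.map_top]
      exact Submodule.FG.map _ (Module.finite_def.1 inferInstance))
  exact inferInstanceAs (Module.FinitePresentation Rᵐᵒᵖ (C × D))

lemma IsClassical.inf_leftPerp_le {T : ModR R} (h : IsClassical T) :
    Gen T ⊓ leftPerp (Gen T) ≤ Add (Gen T ⊓ leftPerp (Gen T) ⊓ finPres R) := by
  obtain ⟨hT, U, hU, hUfp, hTU⟩ := h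
  have hG : Gen T = Gen U := by
    rw [hT.gen_eq_rightPerp, hU.gen_eq_rightPerp]; exact hTU
  rw [hG, hU.gen_inf_leftPerp_eq]
  refine Add_mono ?_
  rintro E rfl
  refine ⟨?_, hUfp⟩
  rw [← hU.gen_inf_leftPerp_eq]
  refine ⟨gen_self _, ?_⟩
  rw [hU.gen_eq_rightPerp]
  exact fun _ h => h

end

end Tilting

/-! ### Assembly of the equivalences. -/

theorem theorem2p6 {R : Type u} [Ring R] (T : Tilting.ModR R) (hT : Tilting.IsOneTilting T)
    (𝒯 : CategoryTheory.ObjectProperty (Tilting.ModR R)) (h𝒯 : 𝒯 = Tilting.Gen T) :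
    List.TFAE
      [ Tilting.IsClassical T,
        𝒯 ⊓ Tilting.leftPerp 𝒯 ≤ Tilting.Add (𝒯 ⊓ Tilting.leftPerp 𝒯 ⊓ Tilting.finPres R),
        ∃ (C : Tilting.ModR R) (φ : Tilting.regular R ⟶ C),
          Tilting.IsSpecialPreenvelope 𝒯 φ ∧ Tilting.finPres R C,
        ∀ A : Tilting.ModR R, Tilting.finPres R A →
          ∃ (C : Tilting.ModR R) (φ : A ⟶ C),
            Tilting.IsSpecialPreenvelope 𝒯 φ ∧ Tilting.finPres R C,
        ∀ A : Tilting.ModR R, Tilting.finPres R A → Tilting.leftPerp 𝒯 A →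
          ∃ (C : Tilting.ModR R) (φ : A ⟶ C),
            Tilting.IsSpecialPreenvelope 𝒯 φ ∧ Tilting.finPres R C ∧ Tilting.AddOne T C ] ∧
    (Tilting.IsClassical T →
      Tilting.IsCovariantlyFinite (𝒯 ⊓ Tilting.finPres R) ∧
        𝒯 = Tilting.directLimits (𝒯 ⊓ Tilting.finPres R)) := by
  subst h𝒯
  have h12 := Tilting.IsClassical.inf_leftPerp_le (T := T)
  have h23 := Tilting.exists_finPres_specialPreenvelope_regular hT
  have h34 : (∃ (C : Tilting.ModR R) (φ : Tilting.regular R ⟶ C),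
        Tilting.IsSpecialPreenvelope (Tilting.Gen T) φ ∧ Tilting.finPres R C) →
      ∀ A : Tilting.ModR R, Tilting.finPres R A → ∃ (C : Tilting.ModR R) (φ : A ⟶ C),
        Tilting.IsSpecialPreenvelope (Tilting.Gen T) φ ∧ Tilting.finPres R C :=
    fun ⟨_, _, hφ, hC⟩ => Tilting.exists_finPres_specialPreenvelope hφ hC
  refine ⟨?_, fun h => ?_⟩
  · tfae_have 1 → 2 := h12
    tfae_have 2 → 3 := h23
    tfae_have 3 → 4 := h34
    tfae_have 4 → 5 := fun h A hA hA' => by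
      obtain ⟨C, φ, hφ, hC⟩ := h A hA
      -- `C` is an extension of the cokernel by `A`, both in `^⊥(Gen T)`, so it lies in `Add T`.
      exact ⟨C, φ, hφ, hC, hT.addOne_of_gen_of_leftPerp hφ.1.1 (hφ.leftPerp hA')⟩
    tfae_have 5 → 1 := fun h => by
      obtain ⟨C, φ, hφ, hC, -⟩ := h _ Tilting.finPres_regular (Tilting.leftPerp_regular _)
      exact Tilting.isClassical_of_specialPreenvelope_regular hT hφ hC
    tfae_finish
  · have h4 := h34 (h23 (h12 h))
    refine ⟨⟨inf_le_right, fun A hA => ?_⟩, le_antisymm (fun M hM => ?_)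
      (Tilting.gen_of_directLimits inf_le_left)⟩
    · obtain ⟨C, φ, hφ, hC⟩ := h4 A hA
      exact ⟨C, φ, ⟨hφ.1.1, hC⟩, fun D f hD => hφ.1.2 D f hD.1⟩
    · refine Tilting.directLimits_of_factorization inf_le_right fun A f hA => ?_
      obtain ⟨C, φ, hφ, hC⟩ := h4 A hA
      obtain ⟨g, hg⟩ := hφ.1.2 M f hM
      exact ⟨C, φ, g, hg, hφ.1.1, hC⟩
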